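/- Let $H$ be an $r$-uniform hypergraph (a finite vertex set $V$ and a set $E$ of edges, which are $r$-element subsets of $V$) with $n$ vertices and $m$ edges, where $r\ge 3$ and $m\ge 5$. A proper colouring of $H$ is a map on $V$ that takes at least two values on each edge. Let $P(H,k)$ be the number of proper colourings with $k$ colours. A $k$-assignment $L$ gives each vertex $v$ a set $L(v)$ of exactly $k$ colours (natural numbers); $P(H,L)$ is the number of proper colourings $\theta$ with $\theta(v)\in L(v)$ for all $v$, and $P_l(H,k)$ is the minimum of $P(H,L)$ over all $k$-assignments $L$. Let $\tau'(H)$ be the smallest positive integer $q$ such that $P_l(H,k)=P(H,k)$ for all integers $k\ge q$. Put $\alpha(e,L)=k-\bigl|\bigcap_{v\in e}L(v)\bigr|$ for $e\in E$, $\alpha(H,L)=\sum_{e\in E}\alpha(e,L)$, and $$\gamma(H)=\max_{e\in E}\bigl|\{e'\in E: |e\cap e'|=r-1\}\bigr|.$$ Suppose that $\gamma(H)\le 0.8(m-1)$. Then for every integer $k\ge 0.6(m-1)+0.5\,\gamma(H)$ and every $k$-assignment $L$ of $H$, $$P(H,L)-P(H,k)\ \ge\ 0.02\,k^{\,n-r}\,\alpha(H,L).$$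 Consequently $P_l(H,k)=P(H,k)$ for every integer $k\ge 0.6(m-1)+0.5\,\gamma(H)$; that is, $\tau'(H)\le\lceil 0.6(m-1)+0.5\,\gamma(H)\rceil$. Moreover $0.6(m-1)+0.5\,\gamma(H)\le m-1$, and hence $\tau'(H)\le m-1$. -/

import Mathlib

namespace Hypergraph

variable {α : Type*} {C : Type*}

/-- `H` is `r`-uniform: every edge has exactly `r` vertices.  For `r ≥ 2` this includes that all
edges have at least two vertices and that no edge is contained in another one. -/
def IsUniform (H : Hypergraph α) (r : ℕ) : Prop :=
  ∀ e ∈ H.edgeSet, e.ncard = r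

/-- A colouring of the vertices of `H` is proper if every edge receives at least two colours. -/
def IsProperColoring (H : Hypergraph α) (θ : H.vertexSet → C) : Prop :=
  ∀ e ∈ H.edgeSet, 2 ≤ (θ '' {v : H.vertexSet | (v : α) ∈ e}).ncard

/-- `P(H, k)`: the number of proper colourings of `H` with `k` colours. -/
noncomputable def chromaticPoly (H : Hypergraph α) (k : ℕ) : ℕ :=
  Nat.card {θ : H.vertexSet → Fin k // H.IsProperColoring θ}

/-- `L` is a `k`-assignment of `H`: every vertex gets a list of exactly `k` colours. -/
def IsAssignment (H : Hypergraph α) (k : ℕ) (L : H.vertexSet → Finset ℕ) : Prop :=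
  ∀ v, (L v).card = k

/-- `P(H, L)`: the number of proper colourings of `H` that choose the colour of each vertex `v`
from the list `L v`. -/
noncomputable def listColorings (H : Hypergraph α) (L : H.vertexSet → Finset ℕ) : ℕ :=
  Nat.card {θ : H.vertexSet → ℕ // (∀ v, θ v ∈ L v) ∧ H.IsProperColoring θ}

/-- The list-color function `P_l(H, k)`: the minimum of `P(H, L)` over all `k`-assignments `L`. -/
noncomputable def listColorFunction (H : Hypergraph α) (k : ℕ) : ℕ :=
  sInf {p : ℕ | ∃ L : H.vertexSet → Finset ℕ, H.IsAssignment k L ∧ H.listColorings L = p}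

/-- `τ'(H)`: the smallest positive integer `q` such that `P_l(H, k) = P(H, k)` for all integers
`k ≥ q` (and `⊤` if there is no such `q`). -/
noncomputable def tauPrime (H : Hypergraph α) : ℕ∞ :=
  sInf {t : ℕ∞ | ∃ q : ℕ, t = (q : ℕ∞) ∧ 0 < q ∧
    ∀ k : ℕ, q ≤ k → H.listColorFunction k = H.chromaticPoly k}

/-- `E_{r-1}(e)`: the edges that have exactly `r - 1` vertices in common with `e`. -/
def nearEdges (H : Hypergraph α) (r : ℕ) (e : Set α) : Set (Set α) :=
  {e' | e' ∈ H.edgeSet ∧ (e ∩ e').ncard + 1 = r}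

/-- `γ(H)`: the maximum of `|E_{r-1}(e)|` over all edges `e` of the (finite, `r`-uniform)
hypergraph `H`. -/
noncomputable def gam (H : Hypergraph α) (r : ℕ) : ℕ :=
  sSup {g : ℕ | ∃ e ∈ H.edgeSet, (H.nearEdges r e).ncard = g}

/-- `α(e, L) = k - |⋂_{v ∈ e} L(v)|`. -/
noncomputable def edgeDefect (H : Hypergraph α) (k : ℕ) (L : H.vertexSet → Finset ℕ)
    (e : Set α) : ℤ :=
  (k : ℤ) - ({c : ℕ | ∀ v : H.vertexSet, (v : α) ∈ e → c ∈ L v}.ncard : ℤ)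

/-- `α(H, L)`: the sum of `α(e, L)` over all edges `e` of the (finite) hypergraph `H`. -/
noncomputable def defect (H : Hypergraph α) (k : ℕ) (L : H.vertexSet → Finset ℕ) : ℤ :=
  ∑ᶠ e ∈ H.edgeSet, H.edgeDefect k L e

end Hypergraph

/-! Write n for the number of vertices, M = m - 1, g = γ(H), x = 1/k, and c(A) for the number of
components (isolated vertices included) of the edges in A. Inclusion–exclusion gives P(H,L) as the
sum over edge sets A of (-1)^|A| times the number of colourings constant on every edge of A; for
constant lists this number is k^c(A). Hence P(H,L) - P(H,k) = -∑ (-1)^|A| f(A), where f(A) ≥ 0 is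
the loss from k^c(A) when the lists are L.

Since f depends only on the components of A, Whitney's cancellation (`sum_eq_sum_not_broken`) leaves
only the sets without a broken edge. In these every edge after the first lowers c, so c(A) ≤ n - r +
2 - |A| (`numComponents_add_le`). A component loses at most as many colours as the total defect of
its edges, so f(A) ≤ k^(c(A)-1) ∑_{e ∈ A} α(e,L) (`mul_pow_sub_monoCount_le`).

Singletons contribute exactly k^(n-r) α(e,L), larger odd sets help and are dropped, and even sets
cost at most k^(n-r) x^(|A|-1) times their defect. A pair meeting in at most r - 2 vertices costs
only x^2 instead of x (`numComponents_pair_add_le`), and each edge has at least M - g such partners.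
Collecting the coefficient of each α(e,L) (`mul_sum_defectAt_le`), it remains to show that ((1+x)^M
- (1-x)^M)/2 - (M-g)(x-x^2) ≤ 0.98 (`cancellation_bound`), which is where the bound on k enters. -/

namespace EdgeFamily

/-! ### Components of a family of edges. -/

variable {V ι : Type*}

/-- The partition of `V` into the connected components of the edges `E i`, `i ∈ A`. -/
def components (E : ι → Finset V) (A : Finset ι) : Setoid V :=
  Relation.EqvGen.setoid fun x y => ∃ i ∈ A, x ∈ E i ∧ y ∈ E i

/-- `θ` is constant on `e`. -/
def Mono {C : Type*} (θ : V → C) (e : Finset V) : Prop :=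
  ∀ x ∈ e, ∀ y ∈ e, θ x = θ y

/-- The edge `E i` lies in a single component of the edges `E j`, `j ∈ A`. -/
def Spanned (E : ι → Finset V) (A : Finset ι) (i : ι) : Prop :=
  ∀ x ∈ E i, ∀ y ∈ E i, components E A x y

theorem components_le_iff {E : ι → Finset V} {A : Finset ι} {s : Setoid V} :
    components E A ≤ s ↔ ∀ i ∈ A, ∀ x ∈ E i, ∀ y ∈ E i, s x y :=
  ⟨fun h i hi _ hx _ hy => h (Relation.EqvGen.rel _ _ ⟨i, hi, hx, hy⟩),
    fun h => Setoid.eqvGen_le fun _ _ ⟨i, hi, hx, hy⟩ => h i hi _ hx _ hy⟩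

theorem components_of_mem {E : ι → Finset V} {A : Finset ι} {i : ι} (hi : i ∈ A) {x y : V}
    (hx : x ∈ E i) (hy : y ∈ E i) : components E A x y :=
  components_le_iff.1 le_rfl i hi x hx y hy

theorem components_mono {E : ι → Finset V} {A B : Finset ι} (h : A ⊆ B) :
    components E A ≤ components E B :=
  components_le_iff.2 fun _ hi _ hx _ hy => components_of_mem (h hi) hx hy

theorem Spanned.mono {E : ι → Finset V} {A B : Finset ι} {i : ι} (h : Spanned E A i)
    (hAB : A ⊆ B) : Spanned E B i :=
  fun x hx y hy => components_mono hAB (h x hx y hy)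

theorem components_insert [DecidableEq ι] {E : ι → Finset V} {A : Finset ι} {i : ι}
    (h : Spanned E A i) : components E (insert i A) = components E A := by
  refine le_antisymm (components_le_iff.2 fun j hj x hx y hy => ?_)
    (components_mono (Finset.subset_insert i A))
  rcases Finset.mem_insert.1 hj with rfl | hj
  · exact h x hx y hy
  · exact components_of_mem hj hx hy

theorem forall_mono_iff {C : Type*} {E : ι → Finset V} {A : Finset ι} {θ : V → C} :
    (∀ i ∈ A, Mono θ (E i)) ↔ ∀ x y, components E A x y → θ x = θ y :=
  (components_le_iff (s := Setoid.ker θ)).symm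

/-- A set closed under the edges it meets contains the component of each of its points. -/
theorem mem_of_components {E : ι → Finset V} {A : Finset ι} {S : Finset V}
    (hS : ∀ i ∈ A, ∀ x ∈ E i, x ∈ S → E i ⊆ S) {x y : V} (h : components E A x y)
    (hx : x ∈ S) : y ∈ S := by
  have := (components_le_iff (E := E) (A := A) (s := Setoid.ker fun v => v ∈ S)).2
    (fun i hi x hx y hy => propext ⟨fun h => hS i hi x hx h hy, fun h => hS i hi y hy h hx⟩) h
  exact this.mp hx

/-- The number of components. -/
noncomputable def numComponents (E : ι → Finset V) (A : Finset ι) : ℕ :=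
  Nat.card (Quotient (components E A))

variable [Fintype V]

theorem numComponents_insert_lt [DecidableEq ι] {E : ι → Finset V} {A : Finset ι} {i : ι}
    (h : ¬ Spanned E A i) : numComponents E (insert i A) < numComponents E A := by
  classical
  simp only [Spanned, not_forall] at h
  obtain ⟨x, hx, y, hy, hxy⟩ := h
  rw [numComponents, numComponents, Nat.card_eq_fintype_card, Nat.card_eq_fintype_card]
  let f : Quotient (components E A) → Quotient (components E (insert i A)) :=
    Quotient.map id fun a b hab => components_mono (Finset.subset_insert i A) hab
  refine Fintype.card_lt_of_surjective_not_injective f ?_ fun hf => hxy ?_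
  · intro q
    induction q using Quotient.inductionOn with
    | h a => exact ⟨⟦a⟧, rfl⟩
  · exact Quotient.exact (hf (Quotient.sound
      (components_of_mem (Finset.mem_insert_self i A) hx hy) :
        f (Quotient.mk _ x) = f (Quotient.mk _ y)))

/-- Every class that has a point in `S` also has a point outside `S`. -/
theorem numComponents_add_card_le {E : ι → Finset V} {A : Finset ι} (S : Finset V)
    (hS : ∀ x ∈ S, ∃ y ∉ S, components E A x y) :
    numComponents E A + S.card ≤ Fintype.card V := by
  classical
  rw [numComponents, Nat.card_eq_fintype_card]
  have : Fintype.card (Quotient (components E A)) ≤ (Sᶜ : Finset V).card := by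
    refine Finset.card_le_card_of_surjOn (Quotient.mk (components E A)) fun q _ => ?_
    induction q using Quotient.inductionOn with
    | h x =>
      by_cases hx : x ∈ S
      · obtain ⟨y, hy, hxy⟩ := hS x hx
        exact ⟨y, by simpa using hy, (Quotient.sound hxy).symm⟩
      · exact ⟨x, by simpa using hx, rfl⟩
  have := Finset.card_add_card_compl S
  omega

end EdgeFamily

/-! ### Inclusion–exclusion and the loss of colours on components. -/

namespace EdgeFamily

variable {V ι : Type*} [Fintype V] [DecidableEq V]

/-- The colours common to the lists of all vertices of a nonempty set `S`. -/
noncomputable def common (L : V → Finset ℕ) (S : Finset V) : Finset ℕ := by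
  classical exact (Finset.univ.biUnion L).filter fun c => ∀ v ∈ S, c ∈ L v

theorem mem_common {L : V → Finset ℕ} {S : Finset V} (hS : S.Nonempty) {c : ℕ} :
    c ∈ common L S ↔ ∀ v ∈ S, c ∈ L v := by
  obtain ⟨v, hv⟩ := hS
  simp only [common, Finset.mem_filter, Finset.mem_biUnion, Finset.mem_univ, true_and,
    and_iff_right_iff_imp]
  exact fun h => ⟨v, h v hv⟩

theorem common_subset {L : V → Finset ℕ} {S : Finset V} {v : V} (hv : v ∈ S) :
    common L S ⊆ L v :=
  fun _ hc => (mem_common ⟨v, hv⟩).1 hc v hv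

open Classical in
/-- The number of colourings from the lists `L` that are constant on `E i` for all `i ∈ A`. -/
noncomputable def monoCount (E : ι → Finset V) (L : V → Finset ℕ) (A : Finset ι) : ℕ :=
  ((Fintype.piFinset L).filter fun θ => ∀ i ∈ A, Mono θ (E i)).card

open Classical in
/-- The number of colourings from the lists `L` that are constant on no edge. -/
noncomputable def properCount (E : ι → Finset V) (L : V → Finset ℕ) : ℕ :=
  ((Fintype.piFinset L).filter fun θ => ∀ i, ¬ Mono θ (E i)).card

/-- Expand the product over i of 1 - [θ is constant on E i] and sum over θ. -/
theorem properCount_eq_sum [Fintype ι] (E : ι → Finset V) (L : V → Finset ℕ) :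
    (properCount E L : ℝ) = ∑ A : Finset ι, (-1) ^ A.card * (monoCount E L A : ℝ) := by
  classical
  have key (θ : V → ℕ) : (if ∀ i, ¬ Mono θ (E i) then (1 : ℝ) else 0) =
      ∑ A : Finset ι, (-1) ^ A.card * (if ∀ i ∈ A, Mono θ (E i) then (1 : ℝ) else 0) := by
    have h1 : (if ∀ i, ¬ Mono θ (E i) then (1 : ℝ) else 0) =
        ∏ i, (1 + if Mono θ (E i) then (-1 : ℝ) else 0) := by
      split_ifs with h
      · simp [h]
      · push Not at h
        obtain ⟨i, hi⟩ := h
        exact (Finset.prod_eq_zero (Finset.mem_univ i) (by simp [hi])).symm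
    rw [h1, Finset.prod_one_add, Finset.powerset_univ]
    refine Finset.sum_congr rfl fun A _ => ?_
    split_ifs with h
    · rw [mul_one, Finset.prod_congr rfl (g := fun _ => (-1 : ℝ)) fun i hi => if_pos (h i hi)]
      simp
    · push Not at h
      obtain ⟨i, hi, hi'⟩ := h
      rw [Finset.prod_eq_zero hi (if_neg hi'), mul_zero]
  simp only [properCount, monoCount, Finset.card_filter, Nat.cast_sum, Nat.cast_ite, Nat.cast_one,
    Nat.cast_zero]
  rw [Finset.sum_congr rfl fun θ _ => key θ, Finset.sum_comm]
  simp only [Finset.mul_sum]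

theorem monoCount_insert_of_spanned [DecidableEq ι] {E : ι → Finset V} {A : Finset ι} {i : ι}
    (L : V → Finset ℕ) (h : Spanned E A i) :
    monoCount E L (insert i A) = monoCount E L A := by
  have (θ : V → ℕ) : (∀ j ∈ insert i A, Mono θ (E j)) ↔ ∀ j ∈ A, Mono θ (E j) := by
    rw [forall_mono_iff, components_insert h, ← forall_mono_iff]
  refine congrArg Finset.card ?_
  ext θ
  simp only [Finset.mem_filter, this]

open Classical in
/-- The vertices of a component. -/
noncomputable def cls (E : ι → Finset V) (A : Finset ι) (q : Quotient (components E A)) :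
    Finset V :=
  Finset.univ.filter fun v => Quotient.mk _ v = q

omit [DecidableEq V] in
theorem mem_cls {E : ι → Finset V} {A : Finset ι} {q : Quotient (components E A)} {v : V} :
    v ∈ cls E A q ↔ Quotient.mk _ v = q := by
  simp [cls]

omit [DecidableEq V] in
theorem cls_nonempty (E : ι → Finset V) (A : Finset ι) (q : Quotient (components E A)) :
    (cls E A q).Nonempty :=
  ⟨q.out, mem_cls.2 q.out_eq⟩

noncomputable instance (E : ι → Finset V) (A : Finset ι) :
    Fintype (Quotient (components E A)) :=
  Fintype.ofFinite _

-- A colouring constant on the edges of A amounts to an independent choice, for each component, of a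
-- colour common to all its lists.
open Classical in
theorem monoCount_eq_prod (E : ι → Finset V) (L : V → Finset ℕ) (A : Finset ι) :
    monoCount E L A = ∏ q, (common L (cls E A q)).card := by
  rw [← Fintype.card_piFinset, monoCount]
  symm
  refine Finset.card_nbij' (fun f v => f (Quotient.mk _ v)) (fun θ q => θ q.out) ?_ ?_ ?_ ?_
  · intro f hf
    have hf : ∀ q, f q ∈ common L (cls E A q) := by simpa using hf
    have : ∀ x y, components E A x y →
        f (Quotient.mk (components E A) x) = f (Quotient.mk (components E A) y) :=
      fun x y h => congrArg f (Quotient.sound h)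
    simp only [Finset.coe_filter, Set.mem_ofPred_eq, Fintype.mem_piFinset]
    exact ⟨fun v => common_subset (mem_cls.2 rfl) (hf _), forall_mono_iff.2 this⟩
  · intro θ hθ
    simp only [Finset.coe_filter, Set.mem_ofPred_eq, Fintype.mem_piFinset] at hθ
    simp only [Finset.mem_coe, Fintype.mem_piFinset]
    intro q
    refine (mem_common (cls_nonempty E A q)).2 fun v hv => ?_
    rw [forall_mono_iff.1 hθ.2 q.out v (Quotient.exact (q.out_eq.trans (mem_cls.1 hv).symm))]
    exact hθ.1 v
  · intro f _
    funext q
    simp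
  · intro θ hθ
    simp only [Finset.coe_filter, Set.mem_ofPred_eq, Fintype.mem_piFinset] at hθ
    funext v
    exact forall_mono_iff.1 hθ.2 _ v (Quotient.exact (Quotient.out_eq _))

open Classical in
theorem monoCount_singleton (E : ι → Finset V) (L : V → Finset ℕ) {i : ι}
    (hi : (E i).Nonempty) :
    monoCount E L {i} = (common L (E i)).card * ∏ v : {v // v ∉ E i}, (L v).card := by
  rw [← Fintype.card_piFinset, ← Finset.card_product, monoCount]
  obtain ⟨w, hw⟩ := hi
  refine Finset.card_nbij' (fun θ => (θ w, fun v => θ v))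
    (fun p v => if h : v ∈ E i then p.1 else p.2 ⟨v, h⟩) ?_ ?_ ?_ ?_
  · intro θ hθ
    simp only [Finset.coe_filter, Set.mem_ofPred_eq, Fintype.mem_piFinset, Finset.mem_singleton,
      forall_eq] at hθ
    simp only [Finset.mem_coe, Finset.mem_product, Fintype.mem_piFinset]
    refine ⟨(mem_common ⟨w, hw⟩).2 fun v hv => ?_, fun v => hθ.1 v⟩
    rw [hθ.2 w hw v hv]
    exact hθ.1 v
  · rintro ⟨c, f⟩ hp
    simp only [Finset.mem_coe, Finset.mem_product, Fintype.mem_piFinset] at hp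
    simp only [Finset.coe_filter, Set.mem_ofPred_eq, Fintype.mem_piFinset, Finset.mem_singleton,
      forall_eq]
    refine ⟨fun v => ?_, fun x hx y hy => by simp [hx, hy]⟩
    split_ifs with h
    · exact common_subset h hp.1
    · exact hp.2 ⟨v, h⟩
  · intro θ hθ
    simp only [Finset.coe_filter, Set.mem_ofPred_eq, Fintype.mem_piFinset, Finset.mem_singleton,
      forall_eq] at hθ
    funext v
    by_cases h : v ∈ E i
    · simpa [h] using hθ.2 w hw v h
    · simp [h]
  · rintro ⟨c, f⟩ _
    ext v
    · simp [hw]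
    · simp [v.2]

/-- The number of colours of a list of length `k` that are not common to the edge. -/
noncomputable def defectAt (k : ℕ) (E : ι → Finset V) (L : V → Finset ℕ) (i : ι) : ℝ :=
  (k : ℝ) - (common L (E i)).card

theorem card_sdiff_common {k : ℕ} {L : V → Finset ℕ} (hL : ∀ v, (L v).card = k)
    {S : Finset V} {v : V} (hv : v ∈ S) :
    ((L v \ common L S).card : ℝ) = k - (common L S).card := by
  rw [Finset.card_sdiff_of_subset (common_subset hv), hL,
    Nat.cast_sub (hL v ▸ Finset.card_le_card (common_subset hv))]

theorem card_common_le {k : ℕ} {L : V → Finset ℕ} (hL : ∀ v, (L v).card = k)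
    {S : Finset V} (hS : S.Nonempty) : (common L S).card ≤ k := by
  obtain ⟨v, hv⟩ := hS
  exact hL v ▸ Finset.card_le_card (common_subset hv)

theorem defectAt_nonneg {k : ℕ} {E : ι → Finset V} {L : V → Finset ℕ}
    (hL : ∀ v, (L v).card = k) {i : ι} (hi : (E i).Nonempty) : 0 ≤ defectAt k E L i :=
  sub_nonneg.2 (Nat.cast_le.2 (card_common_le hL hi))

/-- Growing a connected set by an edge adds at most the defect of the edge. -/
theorem card_sdiff_common_union_le {k : ℕ} {E : ι → Finset V} {L : V → Finset ℕ}
    (hL : ∀ v, (L v).card = k) {S : Finset V} {u x : V} (hu : u ∈ S) {i : ι} (hx : x ∈ E i)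
    (hxS : x ∈ S) :
    ((L u \ common L (S ∪ E i)).card : ℝ) ≤ (L u \ common L S).card + defectAt k E L i := by
  rw [defectAt, ← card_sdiff_common hL hx, ← Nat.cast_add, Nat.cast_le]
  refine (Finset.card_le_card fun c hc => ?_).trans (Finset.card_union_le _ _)
  simp only [Finset.mem_sdiff, Finset.mem_union] at hc ⊢
  by_cases h : c ∈ common L S
  · refine Or.inr ⟨common_subset hxS h, fun h' => hc.2 ?_⟩
    refine (mem_common ⟨u, Finset.mem_union_left _ hu⟩).2 fun v hv => ?_
    rcases Finset.mem_union.1 hv with hv | hv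
    · exact (mem_common ⟨u, hu⟩).1 h v hv
    · exact (mem_common ⟨x, hx⟩).1 h' v hv
  · exact Or.inl ⟨hc.1, h⟩

-- Explore the component from u: while some edge of A leaves S, absorb it, losing at most its
-- defect. B records the absorbed edges, each charged once, and N bounds the number of vertices
-- outside S.
open Classical in
theorem card_sdiff_common_cls_le_aux {k : ℕ} {E : ι → Finset V} {L : V → Finset ℕ}
    (hL : ∀ v, (L v).card = k) (hE : ∀ i, (E i).Nonempty) (A : Finset ι)
    (q : Quotient (components E A)) (u : V) (N : ℕ) :
    ∀ (S : Finset V) (B : Finset ι), u ∈ S → S ⊆ cls E A q → B ⊆ A → (∀ i ∈ B, E i ⊆ S) →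
      ((L u \ common L S).card : ℝ) ≤ ∑ i ∈ B, defectAt k E L i →
      Fintype.card V ≤ N + S.card →
      ((L u \ common L (cls E A q)).card : ℝ) ≤
        ∑ i ∈ A with E i ⊆ cls E A q, defectAt k E L i := by
  induction N using Nat.strong_induction_on with
  | _ N ih =>
  intro S B hu hS hBA hBS hle hN
  by_cases h : ∃ i ∈ A, ∃ x ∈ E i, x ∈ S ∧ ¬ E i ⊆ S
  · obtain ⟨i, hi, x, hx, hxS, hiS⟩ := h
    have hiB : i ∉ B := fun h => hiS (hBS i h)
    have hlt : S.card < (S ∪ E i).card := by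
      refine Finset.card_lt_card ⟨Finset.subset_union_left, fun h => hiS ?_⟩
      exact Finset.subset_union_right.trans h
    have := Finset.card_le_univ (S ∪ E i)
    refine ih (Fintype.card V - (S ∪ E i).card) (by omega) (S ∪ E i) (insert i B)
      (Finset.mem_union_left _ hu) (Finset.union_subset hS fun y hy => ?_)
      (Finset.insert_subset hi hBA) ?_ ?_ (by omega)
    · refine mem_cls.2 (Eq.trans ?_ (mem_cls.1 (hS hxS)))
      exact Quotient.sound (components_of_mem hi hy hx)
    · intro j hj
      rcases Finset.mem_insert.1 hj with rfl | hj
      · exact Finset.subset_union_right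
      · exact (hBS j hj).trans Finset.subset_union_left
    · rw [Finset.sum_insert hiB]
      have := card_sdiff_common_union_le (E := E) hL hu hx hxS
      linarith
  · push Not at h
    have hSq : S = cls E A q := by
      refine hS.antisymm fun y hy => mem_of_components (A := A) h ?_ hu
      exact Quotient.exact ((mem_cls.1 (hS hu)).trans (mem_cls.1 hy).symm)
    rw [← hSq]
    refine hle.trans (Finset.sum_le_sum_of_subset_of_nonneg (fun i hi => ?_)
      fun i _ _ => defectAt_nonneg hL (hE i))
    exact Finset.mem_filter.2 ⟨hBA hi, hBS i hi⟩

open Classical in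
theorem sub_card_common_cls_le {k : ℕ} {E : ι → Finset V} {L : V → Finset ℕ}
    (hL : ∀ v, (L v).card = k) (hE : ∀ i, (E i).Nonempty) (A : Finset ι)
    (q : Quotient (components E A)) :
    (k : ℝ) - (common L (cls E A q)).card ≤
      ∑ i ∈ A with E i ⊆ cls E A q, defectAt k E L i := by
  obtain ⟨u, hu⟩ := cls_nonempty E A q
  rw [← card_sdiff_common hL hu]
  refine card_sdiff_common_cls_le_aux hL hE A q u (Fintype.card V) {u} ∅ (by simp) (by simpa)
    (by simp) (by simp) ?_ (by simp)
  have : L u ⊆ common L {u} := fun c hc => (mem_common (by simp)).2 (by simpa)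
  simp [Finset.sdiff_eq_empty_iff_subset.2 this]

/-- Lowering the factors from K to b q one at a time costs at most K - b q times K to the number of
other factors. The extra factor K on the left avoids the exponent s.card - 1. -/
theorem mul_pow_sub_prod_le {κ : Type*} (s : Finset κ) (b : κ → ℝ) {K : ℝ}
    (hb : ∀ q ∈ s, 0 ≤ b q ∧ b q ≤ K) :
    K * (K ^ s.card - ∏ q ∈ s, b q) ≤ K ^ s.card * ∑ q ∈ s, (K - b q) := by
  classical
  induction s using Finset.induction_on with
  | empty => simp
  | insert a s ha ih =>
    have ih := ih fun q hq => hb q (Finset.mem_insert_of_mem hq)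
    obtain ⟨h0, h1⟩ := hb a (Finset.mem_insert_self a s)
    have hK : 0 ≤ K := h0.trans h1
    rw [Finset.prod_insert ha, Finset.sum_insert ha, Finset.card_insert_of_notMem ha, pow_succ]
    have hP : ∏ q ∈ s, b q ≤ K ^ s.card := by
      rw [← Finset.prod_const]
      exact Finset.prod_le_prod (fun q hq => (hb q (Finset.mem_insert_of_mem hq)).1)
        fun q hq => (hb q (Finset.mem_insert_of_mem hq)).2
    have h2 := mul_le_mul_of_nonneg_left ih hK
    have h3 := mul_le_mul_of_nonneg_left hP (mul_nonneg hK (sub_nonneg.2 h1))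
    nlinarith

theorem monoCount_const_eq {k : ℕ} (E : ι → Finset V) (L : V → Finset ℕ)
    (hc : ∀ v, L v = Finset.range k) (A : Finset ι) :
    monoCount E L A = k ^ numComponents E A := by
  rw [monoCount_eq_prod, numComponents, Nat.card_eq_fintype_card, ← Finset.card_univ,
    ← Finset.prod_const]
  refine Finset.prod_congr rfl fun q _ => ?_
  obtain ⟨v, hv⟩ := cls_nonempty E A q
  have : common L (cls E A q) = Finset.range k := by
    ext c
    rw [mem_common ⟨v, hv⟩]
    exact ⟨fun h => hc v ▸ h v hv, fun h w _ => (hc w).symm ▸ h⟩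
  rw [this, Finset.card_range]

theorem monoCount_le {k : ℕ} (E : ι → Finset V) {L : V → Finset ℕ}
    (hL : ∀ v, (L v).card = k) (A : Finset ι) :
    monoCount E L A ≤ k ^ numComponents E A := by
  rw [monoCount_eq_prod, numComponents, Nat.card_eq_fintype_card, ← Finset.card_univ,
    ← Finset.prod_const]
  exact Finset.prod_le_prod' fun q _ => card_common_le hL (cls_nonempty E A q)

/-- The colour losses of the components add up to at most the total defect of A, because an edge is
contained in at most one component and so is charged at most once. -/
theorem mul_pow_sub_monoCount_le {k : ℕ} {E : ι → Finset V} {L : V → Finset ℕ}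
    (hL : ∀ v, (L v).card = k) (hE : ∀ i, (E i).Nonempty) (A : Finset ι) :
    (k : ℝ) * ((k : ℝ) ^ numComponents E A - monoCount E L A) ≤
      (k : ℝ) ^ numComponents E A * ∑ i ∈ A, defectAt k E L i := by
  classical
  have h := mul_pow_sub_prod_le (Finset.univ : Finset (Quotient (components E A)))
    (fun q => ((common L (cls E A q)).card : ℝ)) (K := k) fun q _ =>
      ⟨Nat.cast_nonneg _, Nat.cast_le.2 (card_common_le hL (cls_nonempty E A q))⟩
  rw [monoCount_eq_prod, numComponents, Nat.card_eq_fintype_card, ← Finset.card_univ]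
  push_cast
  refine h.trans (mul_le_mul_of_nonneg_left ?_ (by positivity))
  refine (Finset.sum_le_sum fun q _ => sub_card_common_cls_le hL hE A q).trans ?_
  simp only [Finset.sum_filter]
  rw [Finset.sum_comm]
  refine Finset.sum_le_sum fun i _ => ?_
  obtain ⟨x, hx⟩ := hE i
  rw [Finset.sum_eq_single (Quotient.mk _ x)]
  · split_ifs
    · exact le_rfl
    · exact defectAt_nonneg hL (hE i)
  · intro q _ hq
    exact if_neg fun h => hq (mem_cls.1 (h hx)).symm
  · simp

end EdgeFamily

/-! ### Broken edges and Whitney's cancellation. -/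

namespace EdgeFamily

variable {V ι : Type*} [LinearOrder ι]

/-- The edge `E i` lies in a single component of the later edges of `A`. -/
def Broken (E : ι → Finset V) (A : Finset ι) (i : ι) : Prop :=
  Spanned E (A.filter (i < ·)) i

theorem Broken.mono {E : ι → Finset V} {A B : Finset ι} {i : ι} (h : Broken E A i)
    (hAB : A ⊆ B) : Broken E B i :=
  Spanned.mono h (Finset.filter_subset_filter _ hAB)

theorem symmDiff_singleton_eq (S : Finset ι) (i : ι) :
    (i ∈ S ∧ symmDiff S {i} = S.erase i ∧ S = insert i (S.erase i)) ∨
      (i ∉ S ∧ symmDiff S {i} = insert i S ∧ S.erase i = S) := by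
  by_cases h : i ∈ S
  · refine Or.inl ⟨h, ?_, (Finset.insert_erase h).symm⟩
    ext j
    by_cases hj : j = i <;> simp [Finset.mem_symmDiff, hj, h]
  · refine Or.inr ⟨h, ?_, Finset.erase_eq_of_notMem h⟩
    ext j
    by_cases hj : j = i <;> simp [Finset.mem_symmDiff, hj, h]

theorem components_symmDiff {E : ι → Finset V} {S : Finset ι} {i : ι}
    (h : Spanned E (S.erase i) i) : components E (symmDiff S {i}) = components E S := by
  have h' := components_insert h
  rcases symmDiff_singleton_eq S i with ⟨_, h1, h2⟩ | ⟨_, h1, h2⟩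
  · rw [h1, ← h', ← h2]
  · rw [h2] at h'
    rw [h1, h']

theorem filter_symmDiff (p : ι → Prop) [DecidablePred p] (S : Finset ι) (i : ι) :
    (symmDiff S {i}).filter p = if p i then symmDiff (S.filter p) {i} else S.filter p := by
  split_ifs with h <;> ext j <;> by_cases hj : j = i <;> simp [Finset.mem_symmDiff, hj, h]

/-- Toggling i affects only the tests for j < i, and there the components stay the same because the
edges after i already span E i. This keeps the least broken index fixed under the toggle. -/
theorem broken_symmDiff_iff {E : ι → Finset V} {A : Finset ι} {i j : ι} (h : Broken E A i) :
    Broken E (symmDiff A {i}) j ↔ Broken E A j := by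
  rw [Broken, filter_symmDiff]
  split_ifs with hji
  · rw [Spanned, components_symmDiff]
    · rfl
    · refine Spanned.mono h fun l hl => ?_
      simp only [Finset.mem_filter, Finset.mem_erase] at hl ⊢
      exact ⟨hl.2.ne', hl.1, hji.trans hl.2⟩
  · rfl

variable [Fintype ι]

open Classical in
/-- Whitney's broken-cycle cancellation. -/
theorem sum_eq_sum_not_broken (E : ι → Finset V) (f : Finset ι → ℝ)
    (hf : ∀ A i, Spanned E A i → f (insert i A) = f A) :
    ∑ A : Finset ι, (-1) ^ A.card * f A =
      ∑ A : Finset ι with ∀ i, ¬ Broken E A i, (-1) ^ A.card * f A := by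
  rw [← Finset.sum_filter_add_sum_filter_not Finset.univ (fun A => ∀ i, ¬ Broken E A i),
    add_eq_left]
  -- The sign-reversing involution toggles the least broken index, whether or not it belongs to A.
  have hleast (A : Finset ι) (hA : A ∈ Finset.univ.filter fun A => ¬ ∀ i, ¬ Broken E A i) :
      ∃ i, Broken E A i ∧ ∀ j < i, ¬ Broken E A j := by
    have hne : (Finset.univ.filter (Broken E A)).Nonempty := by
      simpa [Finset.filter_nonempty_iff] using hA
    refine ⟨_, (Finset.mem_filter.1 (Finset.min'_mem _ hne)).2, fun j hj hb => ?_⟩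
    exact (Finset.min'_le _ j (by simpa using hb)).not_gt hj
  choose g hg using hleast
  refine Finset.sum_involution (fun A hA => symmDiff A {g A hA}) ?_ ?_ ?_ ?_
  · intro A hA
    have hb := (hg A hA).1
    rcases symmDiff_singleton_eq A (g A hA) with ⟨h0, h1, h2⟩ | ⟨h0, h1, h2⟩
    · have hs : Spanned E (A.erase (g A hA)) (g A hA) := Spanned.mono hb fun l hl => by
        simp only [Finset.mem_filter, Finset.mem_erase] at hl ⊢
        exact ⟨hl.2.ne', hl.1⟩
      have h3 := hf _ _ hs
      rw [← h2] at h3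
      rw [h1, h3, ← Finset.card_erase_add_one h0, pow_succ]
      ring
    · rw [h1, hf _ _ (Spanned.mono hb (Finset.filter_subset _ _)),
        Finset.card_insert_of_notMem h0, pow_succ]
      ring
  · intro A hA _ h
    have := congrArg (g A hA ∈ ·) h
    simp [Finset.mem_symmDiff] at this
  · intro A hA
    simp only [Finset.mem_filter, Finset.mem_univ, true_and, not_forall, not_not]
    exact ⟨g A hA, (broken_symmDiff_iff (hg A hA).1).2 (hg A hA).1⟩
  · intro A hA
    generalize_proofs h1
    have hg' : g _ h1 = g A hA := by
      rcases lt_trichotomy (g _ h1) (g A hA) with h | h | h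
      · exact absurd ((broken_symmDiff_iff (hg A hA).1).1 (hg _ h1).1) ((hg A hA).2 _ h)
      · exact h
      · exact absurd ((broken_symmDiff_iff (hg A hA).1).2 (hg A hA).1) ((hg _ h1).2 _ h)
    rw [hg', symmDiff_symmDiff_cancel_right]

-- A single edge spans only its own subsets of size at least two, and distinct edges of equal size
-- are not nested. So the singletons, which carry the main term, all survive the cancellation.
omit [Fintype ι] in
theorem not_broken_singleton {E : ι → Finset V} (hinj : Function.Injective E) {r : ℕ} (hr : 2 ≤ r)
    (hE : ∀ i, (E i).card = r) (i j : ι) : ¬ Broken E {i} j := by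
  intro h
  obtain ⟨x, hx, y, hy, hxy⟩ := Finset.one_lt_card.1 (by rw [hE j]; omega : 1 < (E j).card)
  by_cases hji : j < i
  · have hb (z : V) (hz : z ∈ E j) : z ∈ E i := by
      obtain ⟨w, hw, hwz⟩ : ∃ w ∈ E j, w ≠ z := by
        by_cases hxz : x = z
        · exact ⟨y, hy, fun h => hxy (hxz.trans h.symm)⟩
        · exact ⟨x, hx, hxz⟩
      by_contra hzi
      refine hwz (Finset.mem_singleton.1
        (mem_of_components (S := {z}) ?_ (h z hz w hw) (Finset.mem_singleton_self z)))
      intro l hl v hv hvz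
      rw [Finset.mem_singleton.1 (Finset.mem_filter.1 hl).1, Finset.mem_singleton.1 hvz] at hv
      exact absurd hv hzi
    exact hji.ne (hinj (Finset.eq_of_subset_of_card_le hb (by rw [hE, hE])))
  · refine hxy (Finset.mem_singleton.1
        (mem_of_components (S := {x}) ?_ (h x hx y hy) (Finset.mem_singleton_self x))).symm
    intro l hl
    rw [Finset.mem_filter, Finset.mem_singleton] at hl
    exact absurd (hl.1 ▸ hl.2) hji

/-! ### Component bounds and the weighted comparison. -/

variable [Fintype V]

-- Add the edges from last to first: the first one added leaves at most n - r + 1 components, and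
-- every further one, not being spanned by the later ones, merges at least two.
omit [Fintype ι] in
theorem numComponents_add_le {E : ι → Finset V} {r : ℕ} (hr : 1 ≤ r)
    (hE : ∀ i, (E i).card = r) (A : Finset ι) (hA : A.Nonempty) (hb : ∀ i, ¬ Broken E A i) :
    numComponents E A + r + A.card ≤ Fintype.card V + 2 := by
  classical
  induction A using Finset.induction_on_min with
  | empty => simp at hA
  | insert a s has ih =>
    rcases s.eq_empty_or_nonempty with rfl | hs
    · obtain ⟨v, hv⟩ : (E a).Nonempty := Finset.card_pos.1 (by rw [hE]; omega)
      have := numComponents_add_card_le (E := E) (A := insert a ∅) ((E a).erase v)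
        fun x hx => ⟨v, by simp, components_of_mem (Finset.mem_insert_self a ∅)
          (Finset.mem_of_mem_erase hx) hv⟩
      rw [Finset.card_erase_of_mem hv, hE] at this
      simp only [insert_empty_eq, Finset.card_singleton] at this ⊢
      omega
    · have h1 := ih hs fun i hi => hb i (hi.mono (Finset.subset_insert a s))
      have ha : ¬ Spanned E s a := fun h => hb a (h.mono fun l hl =>
        Finset.mem_filter.2 ⟨Finset.mem_insert_of_mem hl, has l hl⟩)
      have h2 := numComponents_insert_lt ha
      rw [Finset.card_insert_of_notMem fun h => lt_irrefl a (has a h)]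
      omega

-- Meeting edges form one component on at least r + 2 vertices. Disjoint edges form two components
-- on 2r vertices, and n - 2r + 2 ≤ n - r - 1 is where r ≥ 3 is needed.
omit [Fintype ι] in
theorem numComponents_pair_add_le [DecidableEq V] {E : ι → Finset V} {r : ℕ} (hr : 3 ≤ r)
    (hE : ∀ i, (E i).card = r) {i j : ι} (hij : (E i ∩ E j).card + 2 ≤ r) :
    numComponents E {i, j} + r + 1 ≤ Fintype.card V := by
  have hi {x y : V} (hx : x ∈ E i) (hy : y ∈ E i) : components E {i, j} x y :=
    components_of_mem (by simp) hx hy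
  have hj {x y : V} (hx : x ∈ E j) (hy : y ∈ E j) : components E {i, j} x y :=
    components_of_mem (by simp) hx hy
  have hcard := Finset.card_union_add_card_inter (E i) (E j)
  rw [hE, hE] at hcard
  rcases (E i ∩ E j).eq_empty_or_nonempty with h | ⟨v, hv⟩
  · obtain ⟨v, hv⟩ : (E i).Nonempty := Finset.card_pos.1 (by rw [hE]; omega)
    obtain ⟨w, hw⟩ : (E j).Nonempty := Finset.card_pos.1 (by rw [hE]; omega)
    have hdisj (x : V) (h1 : x ∈ E i) (h2 : x ∈ E j) : False := by
      have := Finset.mem_inter.2 ⟨h1, h2⟩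
      simp [h] at this
    have := numComponents_add_card_le (E := E) (A := {i, j}) (((E i ∪ E j).erase v).erase w) ?_
    · rw [Finset.card_erase_of_mem, Finset.card_erase_of_mem] at this
      · rw [h, Finset.card_empty] at hcard
        omega
      · exact Finset.mem_union_left _ hv
      · refine Finset.mem_erase.2 ⟨?_, Finset.mem_union_right _ hw⟩
        rintro rfl
        exact hdisj _ hv hw
    · intro x hx
      simp only [Finset.mem_erase, Finset.mem_union] at hx
      rcases hx.2.2 with h | h
      · exact ⟨v, by simp, hi h hv⟩
      · exact ⟨w, by simp, hj h hw⟩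
  · have := numComponents_add_card_le (E := E) (A := {i, j}) ((E i ∪ E j).erase v) ?_
    · rw [Finset.card_erase_of_mem
        (Finset.mem_union_left _ (Finset.mem_inter.1 hv).1)] at this
      omega
    · intro x hx
      simp only [Finset.mem_erase, Finset.mem_union] at hx
      rcases hx.2 with h | h
      · exact ⟨v, by simp, hi h (Finset.mem_inter.1 hv).1⟩
      · exact ⟨v, by simp, hj h (Finset.mem_inter.1 hv).2⟩

/-- The weight that bounds the contribution of a set `A` of edges. -/
noncomputable def weight (E : ι → Finset V) (r : ℕ) (x : ℝ) (A : Finset ι) : ℝ :=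
  (if A.card = 1 then 1 else 0) - (if Even A.card then x ^ (A.card - 1) else 0) +
    (if A.card = 2 ∧ numComponents E A + r + 1 ≤ Fintype.card V then x - x ^ 2 else 0)

/-- Put A = B ∪ {i}. Even |A| means odd |B|, so the binomial theorem turns the even sets into the
odd part of (1+x)^M, and each of the at least M - g edges sharing at most r - 2 vertices with E i
returns x - x^2. -/
theorem le_sum_weight [DecidableEq V] {E : ι → Finset V} {r g : ℕ} (hr : 3 ≤ r)
    (hinj : Function.Injective E) (hE : ∀ i, (E i).card = r) {x : ℝ} (hx0 : 0 ≤ x) (hx1 : x ≤ 1)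
    (i : ι) (hg : (Finset.univ.filter fun j => (E i ∩ E j).card + 1 = r).card ≤ g) {M : ℕ}
    (hM : Fintype.card ι = M + 1) :
    1 - (((1 + x) ^ M - (1 - x) ^ M) / 2 - (M - g) * (x - x ^ 2)) ≤
      ∑ A : Finset ι with i ∈ A, weight E r x A := by
  have hcard : (Finset.univ.erase i).card = M := by
    rw [Finset.card_erase_of_mem (Finset.mem_univ i), Finset.card_univ, hM, Nat.add_sub_cancel]
  have hbij : ∑ A : Finset ι with i ∈ A, weight E r x A =
      ∑ B ∈ (Finset.univ.erase i).powerset, weight E r x (insert i B) := by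
    refine Finset.sum_bij' (fun A _ => A.erase i) (fun B _ => insert i B) ?_ ?_ ?_ ?_ ?_
    · intro A _
      exact Finset.mem_powerset.2 (Finset.erase_subset_erase i (Finset.subset_univ A))
    · intro B _
      simp
    · intro A hA
      exact Finset.insert_erase (by simpa using hA)
    · intro B hB
      exact Finset.erase_insert fun h => by simpa using Finset.mem_powerset.1 hB h
    · intro A hA
      rw [Finset.insert_erase (by simpa using hA)]
  have hw (B : Finset ι) (hB : B ∈ (Finset.univ.erase i).powerset) :
      -- The expression (x^b - (-x)^b)/2 is x^b for odd b and 0 for even b.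
      weight E r x (insert i B) = (if B = ∅ then 1 else 0) -
        (x ^ B.card - (-x) ^ B.card) / 2 +
        (if B.card = 1 ∧ numComponents E (insert i B) + r + 1 ≤ Fintype.card V
          then x - x ^ 2 else 0) := by
    have hi : i ∉ B := fun h => by simpa using Finset.mem_powerset.1 hB h
    rw [weight, Finset.card_insert_of_notMem hi]
    congr 2
    · simp
    · rcases Nat.even_or_odd B.card with h | h
      · rw [if_neg (by simpa [Nat.even_add_one] using h), h.neg_pow]
        simp
      · rw [if_pos (by simpa [Nat.even_add_one] using h), h.neg_pow, Nat.add_sub_cancel]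
        ring
    · simp
  rw [hbij, Finset.sum_congr rfl hw, Finset.sum_add_distrib, Finset.sum_sub_distrib,
    ← Finset.sum_div, Finset.sum_sub_distrib]
  have hpow (y : ℝ) : ∑ B ∈ (Finset.univ.erase i).powerset, y ^ B.card = (1 + y) ^ M := by
    have := Finset.sum_pow_mul_eq_add_pow y 1 (Finset.univ.erase i)
    rw [hcard] at this
    simpa [add_comm] using this
  rw [hpow, hpow, Finset.sum_ite_eq' _ ∅, if_pos (Finset.empty_mem_powerset _)]
  have hfar : ((M : ℝ) - g) * (x - x ^ 2) ≤ ∑ B ∈ (Finset.univ.erase i).powerset,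
      (if B.card = 1 ∧ numComponents E (insert i B) + r + 1 ≤ Fintype.card V
          then x - x ^ 2 else 0) := by
    rw [← Finset.sum_filter, Finset.sum_const, nsmul_eq_mul]
    refine mul_le_mul_of_nonneg_right ?_ (by nlinarith)
    rw [sub_le_iff_le_add, ← Nat.cast_add, Nat.cast_le]
    have h1 : ((Finset.univ.erase i).filter fun j => ¬ (E i ∩ E j).card + 1 = r).card ≤
        ((Finset.univ.erase i).powerset.filter fun B => B.card = 1 ∧
          numComponents E (insert i B) + r + 1 ≤ Fintype.card V).card := by
      refine Finset.card_le_card_of_injOn (fun j => {j}) (fun j hj => ?_)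
        (Finset.singleton_injective.injOn)
      simp only [Finset.coe_filter, Set.mem_ofPred_eq, Finset.mem_erase] at hj
      simp only [Finset.coe_filter, Set.mem_ofPred_eq, Finset.mem_powerset,
        Finset.singleton_subset_iff, Finset.card_singleton, true_and, Finset.mem_erase]
      refine ⟨hj.1, numComponents_pair_add_le hr hE ?_⟩
      have h3 : (E i ∩ E j).card < r := by
        rw [← hE i]
        refine Finset.card_lt_card ⟨Finset.inter_subset_left, fun h => hj.1.1 ?_⟩
        exact (hinj (Finset.eq_of_subset_of_card_le (h.trans Finset.inter_subset_right)
          (by rw [hE, hE]))).symm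
      have := hj.2
      omega
    have h2 := Finset.card_filter_add_card_filter_not (s := Finset.univ.erase i)
      (fun j => (E i ∩ E j).card + 1 = r)
    have h4 : ((Finset.univ.erase i).filter fun j => (E i ∩ E j).card + 1 = r).card ≤ g :=
      (Finset.card_le_card (Finset.filter_subset_filter _ (Finset.subset_univ _))).trans hg
    omega
  have e : (1 : ℝ) + -x = 1 - x := by ring
  rw [e]
  linarith

-- For a single edge the loss is known exactly; k^c({i}) is evaluated by the same singleton count
-- applied to constant lists.
omit [LinearOrder ι] [Fintype ι] in
theorem sub_monoCount_singleton [DecidableEq V] {k r : ℕ} {E : ι → Finset V} {L : V → Finset ℕ}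
    (hr : 1 ≤ r) (hL : ∀ v, (L v).card = k) (hE : ∀ i, (E i).card = r) (i : ι) :
    (k : ℝ) ^ numComponents E {i} - monoCount E L {i} =
      (k : ℝ) ^ (Fintype.card V - r) * defectAt k E L i := by
  classical
  have hi : (E i).Nonempty := Finset.card_pos.1 (by rw [hE]; omega)
  have hc : Fintype.card {v // v ∉ E i} = Fintype.card V - r := by
    rw [Fintype.card_subtype_compl, Fintype.card_coe, hE]
  have h1 := monoCount_const_eq E (fun _ => Finset.range k) (fun _ => rfl) {i}
  have h2 : common (fun _ : V => Finset.range k) (E i) = Finset.range k := by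
    obtain ⟨v, hv⟩ := hi
    ext c
    rw [mem_common ⟨v, hv⟩]
    exact ⟨fun h => h v hv, fun h _ _ => h⟩
  rw [monoCount_singleton _ _ hi, h2, Finset.card_range] at h1
  rw [← Nat.cast_pow, ← h1, monoCount_singleton _ _ hi]
  simp only [hL, Finset.prod_const, Finset.card_univ, hc, defectAt]
  push_cast
  ring

theorem mul_sum_defectAt_le [DecidableEq V] {k r g M : ℕ} {E : ι → Finset V} {L : V → Finset ℕ}
    (hk : 1 ≤ k) (hr : 3 ≤ r) (hL : ∀ v, (L v).card = k) (hinj : Function.Injective E)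
    (hE : ∀ i, (E i).card = r)
    (hg : ∀ i, (Finset.univ.filter fun j => (E i ∩ E j).card + 1 = r).card ≤ g)
    (hM : Fintype.card ι = M + 1) {x : ℝ} (hx : x * k = 1) :
    (k : ℝ) ^ (Fintype.card V - r) *
      ((1 - (((1 + x) ^ M - (1 - x) ^ M) / 2 - (M - g) * (x - x ^ 2))) *
        ∑ i, defectAt k E L i) ≤
      properCount E L - properCount E (fun _ => Finset.range k) := by
  classical
  have hk0 : (0 : ℝ) < k := by exact_mod_cast hk
  have hk1 : (1 : ℝ) ≤ k := by exact_mod_cast hk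
  have hx0 : 0 < x := pos_of_mul_pos_left (by rw [hx]; exact one_pos) hk0.le
  have hx1 : x ≤ 1 := by nlinarith
  have hne (i : ι) : (E i).Nonempty := Finset.card_pos.1 (by rw [hE]; omega)
  set K : ℝ := (k : ℝ) ^ (Fintype.card V - r) with hK
  have hKpos : 0 < K := by positivity
  set f : Finset ι → ℝ := fun A => (k : ℝ) ^ numComponents E A - monoCount E L A with hf
  have hf0 (A : Finset ι) : 0 ≤ f A := by
    have := monoCount_le E hL A
    rw [hf, sub_nonneg]
    exact_mod_cast this
  have ha0 (A : Finset ι) : 0 ≤ ∑ i ∈ A, defectAt k E L i :=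
    Finset.sum_nonneg fun i _ => defectAt_nonneg hL (hne i)
  have hD : (properCount E L : ℝ) - properCount E (fun _ => Finset.range k) =
      - ∑ A : Finset ι with ∀ i, ¬ Broken E A i, (-1) ^ A.card * f A := by
    rw [← sum_eq_sum_not_broken E f, properCount_eq_sum, properCount_eq_sum,
      ← Finset.sum_sub_distrib, ← Finset.sum_neg_distrib]
    · refine Finset.sum_congr rfl fun A _ => ?_
      rw [monoCount_const_eq E _ (fun _ => rfl) A]
      simp only [hf]
      push_cast
      ring
    · intro A i h
      simp only [hf]
      rw [monoCount_insert_of_spanned L h, numComponents, numComponents, components_insert h]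
  -- Each component short of n - r + 1, the maximum for a single edge, gains a factor x = 1/k.
  have hbound (A : Finset ι) (s : ℕ) (hs : numComponents E A + s ≤ Fintype.card V - r + 1) :
      f A ≤ K * x ^ s * ∑ i ∈ A, defectAt k E L i := by
    refine le_of_mul_le_mul_left ((mul_pow_sub_monoCount_le hL hne A).trans ?_) hk0
    have : (k : ℝ) ^ numComponents E A ≤ k * (K * x ^ s) := by
      calc (k : ℝ) ^ numComponents E A = (x * k) ^ s * (k : ℝ) ^ numComponents E A := by
            rw [hx, one_pow, one_mul]
        _ = x ^ s * (k : ℝ) ^ (numComponents E A + s) := by rw [mul_pow, pow_add]; ring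
        _ ≤ x ^ s * (k : ℝ) ^ (Fintype.card V - r + 1) := by gcongr
        _ = k * (K * x ^ s) := by rw [hK, pow_succ]; ring
    calc _ ≤ k * (K * x ^ s) * ∑ i ∈ A, defectAt k E L i :=
          mul_le_mul_of_nonneg_right this (ha0 A)
      _ = _ := by ring
  have hweight (A : Finset ι) (hA : ∀ i, ¬ Broken E A i) :
      K * (weight E r x A * ∑ i ∈ A, defectAt k E L i) ≤ -((-1) ^ A.card * f A) := by
    rcases A.eq_empty_or_nonempty with rfl | hAne
    -- The truncated exponent 0 - 1 makes the weight of ∅ equal to -1, harmlessly: its total defect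
    -- is zero.
    · have h1 := mul_pow_sub_monoCount_le hL hne ∅
      have h2 : f ∅ ≤ 0 := by
        rw [Finset.sum_empty, mul_zero] at h1
        exact nonpos_of_mul_nonpos_right h1 hk0
      simpa using h2
    have hnc := numComponents_add_le (by omega) hE A hAne hA
    -- This makes the natural-number subtraction n - r exact.
    have hrV : r ≤ Fintype.card V := by
      obtain ⟨i, _⟩ := hAne
      exact hE i ▸ Finset.card_le_univ _
    rcases Nat.even_or_odd A.card with he | ho
    · have hpos := hAne.card_pos
      have h2 : 2 ≤ A.card := by
        obtain ⟨t, ht⟩ := he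
        omega
      rw [he.neg_one_pow, one_mul]
      by_cases hfar : A.card = 2 ∧ numComponents E A + r + 1 ≤ Fintype.card V
      · have := hbound A 2 (by omega)
        rw [weight, if_neg (by omega), if_pos he, if_pos hfar, hfar.1]
        norm_num
        linarith
      · have := hbound A (A.card - 1) (by omega)
        rw [weight, if_neg (by omega), if_pos he, if_neg hfar]
        linarith
    · have hn2 : A.card ≠ 2 := fun h => by rw [h] at ho; exact absurd ho (by decide)
      rw [ho.neg_one_pow, weight, if_neg (Nat.not_even_iff_odd.2 ho), if_neg (c := _ ∧ _) fun h => hn2 h.1]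
      split_ifs with h1
      · obtain ⟨i, rfl⟩ := Finset.card_eq_one.1 h1
        simp only [hf, sub_monoCount_singleton (by omega) hL hE i, Finset.sum_singleton]
        linarith
      · have := hf0 A
        linarith
  -- The coefficient of an edge is a sum over all sets containing it, broken or not. Broken sets are
  -- not singletons, so their weight is nonpositive and including them only weakens the lower bound.
  have hbroken (A : Finset ι) (hA : ¬ ∀ i, ¬ Broken E A i) : weight E r x A ≤ 0 := by
    have h1 : A.card ≠ 1 := by
      intro h
      obtain ⟨i, rfl⟩ := Finset.card_eq_one.1 h
      exact hA fun j => not_broken_singleton hinj (by omega) hE i j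
    rw [weight, if_neg h1]
    have hpow : 0 ≤ x ^ (A.card - 1) := by positivity
    have hsq : 0 ≤ x ^ 2 := by positivity
    split_ifs with h2 h3 h3
    · rw [h3.1, Nat.add_sub_cancel 1 1]
      linarith
    · linarith
    · exact absurd (h3.1 ▸ even_two) h2
    · linarith
  rw [hD, ← Finset.sum_neg_distrib]
  calc K * ((1 - (((1 + x) ^ M - (1 - x) ^ M) / 2 - (M - g) * (x - x ^ 2))) *
        ∑ i, defectAt k E L i)
      ≤ K * ∑ i, (∑ A : Finset ι with i ∈ A, weight E r x A) * defectAt k E L i := by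
        rw [Finset.mul_sum]
        refine mul_le_mul_of_nonneg_left (Finset.sum_le_sum fun i _ => ?_) hKpos.le
        exact mul_le_mul_of_nonneg_right (le_sum_weight hr hinj hE hx0.le hx1 i (hg i) hM)
          (defectAt_nonneg hL (hne i))
    _ = ∑ A : Finset ι, K * (weight E r x A * ∑ i ∈ A, defectAt k E L i) := by
        rw [← Finset.mul_sum]
        congr 1
        simp only [Finset.sum_mul, Finset.mul_sum, Finset.sum_filter]
        rw [Finset.sum_comm]
        refine Finset.sum_congr rfl fun A _ => ?_
        simp
    _ ≤ ∑ A : Finset ι with ∀ i, ¬ Broken E A i,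
          K * (weight E r x A * ∑ i ∈ A, defectAt k E L i) := by
        rw [← Finset.sum_filter_add_sum_filter_not Finset.univ (fun A => ∀ i, ¬ Broken E A i),
          add_le_iff_nonpos_right]
        refine Finset.sum_nonpos fun A hA => ?_
        have := mul_nonneg_of_nonpos_of_nonpos (hbroken A (Finset.mem_filter.1 hA).2)
          (neg_nonpos.2 (ha0 A))
        nlinarith
    _ ≤ _ := Finset.sum_le_sum fun A hA => hweight A (Finset.mem_filter.1 hA).2

end EdgeFamily

/-! ### The real inequality behind the constant 0.02. -/

section RealBounds

theorem cast_choose_three (M : ℕ) :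
    (M.choose 3 : ℝ) = M * (M - 1) * (M - 2) / 6 := by
  induction M with
  | zero => simp
  | succ M ih =>
    rw [Nat.choose_succ_succ' M 2, Nat.cast_add, ih, Nat.cast_choose_two]
    push_cast
    ring

theorem choose_add_two_mul_le (M i : ℕ) :
    M.choose (i + 2) * ((i + 1) * (i + 2)) ≤ M.choose i * M ^ 2 := by
  have h1 := Nat.choose_succ_right_eq M (i + 1)
  have h2 := Nat.choose_succ_right_eq M i
  calc M.choose (i + 2) * ((i + 1) * (i + 2))
      = M.choose (i + 1 + 1) * (i + 1 + 1) * (i + 1) := by ring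
    _ = M.choose i * (M - i) * (M - (i + 1)) := by rw [h1, mul_right_comm, h2]
    _ ≤ M.choose i * M * M := by gcongr <;> omega
    _ = _ := by ring

/-- The odd part of the binomial expansion. -/
theorem sub_pow_div_two_eq_sum (M : ℕ) (x : ℝ) :
    ((1 + x) ^ M - (1 - x) ^ M) / 2 =
      ∑ j ∈ Finset.range (M + 2), (M.choose (2 * j + 1) : ℝ) * x ^ (2 * j + 1) := by
  have h1 (y : ℝ) : (1 + y) ^ M = ∑ i ∈ Finset.range (2 * (M + 2)), (M.choose i : ℝ) * y ^ i := by
    rw [add_comm, add_pow]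
    simp only [one_pow, mul_one]
    rw [Finset.sum_congr rfl fun i _ => mul_comm (y ^ i) _]
    refine Finset.sum_subset (Finset.range_subset_range.2 (by omega)) fun i _ hi => ?_
    rw [Nat.choose_eq_zero_of_lt (by simpa using hi), Nat.cast_zero, zero_mul]
  have h2 (N : ℕ) : (∑ i ∈ Finset.range (2 * N), (M.choose i : ℝ) * x ^ i -
      ∑ i ∈ Finset.range (2 * N), (M.choose i : ℝ) * (-x) ^ i) / 2 =
      ∑ j ∈ Finset.range N, (M.choose (2 * j + 1) : ℝ) * x ^ (2 * j + 1) := by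
    induction N with
    | zero => simp
    | succ N ih =>
      rw [Finset.sum_range_succ _ N, ← ih, Nat.mul_succ, Finset.sum_range_succ,
        Finset.sum_range_succ, Finset.sum_range_succ, Finset.sum_range_succ,
        (even_two_mul N).neg_pow, (odd_two_mul_add_one N).neg_pow]
      ring
  rw [sub_eq_add_neg 1 x, h1, h1, h2]

/-- The terms of degree 1 and 3 are kept exactly; those from degree 5 on are dominated by a
geometric series of ratio 1/15. -/
theorem odd_part_le (M : ℕ) {x : ℝ} (hx : 0 ≤ x) (ht : (M : ℝ) * x ≤ 5 / 3) :
    ((1 + x) ^ M - (1 - x) ^ M) / 2 ≤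
      M * x + (M : ℝ) * (M - 1) * (M - 2) / 6 * x ^ 3 + (M * x) ^ 5 / 112 := by
  set u : ℕ → ℝ := fun j => (M.choose (2 * j + 1) : ℝ) * x ^ (2 * j + 1) with hu
  -- From degree 5 on, consecutive terms have ratio at most (M x)^2 / (6 · 7), and (5/3)^2 / 42 <
  -- 1/15.
  have hratio (j : ℕ) : u (j + 3) ≤ u (j + 2) / 15 := by
    have h1 : (M.choose (2 * (j + 2) + 1 + 2) : ℝ) *
        ((2 * ((j : ℝ) + 2) + 1 + 1) * (2 * ((j : ℝ) + 2) + 1 + 2)) ≤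
        M.choose (2 * (j + 2) + 1) * (M : ℝ) ^ 2 := by
      exact_mod_cast choose_add_two_mul_le M (2 * (j + 2) + 1)
    have h2 : (42 : ℝ) ≤ (2 * ((j : ℝ) + 2) + 1 + 1) * (2 * ((j : ℝ) + 2) + 1 + 2) := by
      have : (0 : ℝ) ≤ j := j.cast_nonneg
      nlinarith
    have h3 : (M.choose (2 * (j + 2) + 1 + 2) : ℝ) * 42 ≤
        M.choose (2 * (j + 2) + 1) * (M : ℝ) ^ 2 :=
      (mul_le_mul_of_nonneg_left h2 (Nat.cast_nonneg _)).trans h1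
    have h4 : ((M : ℝ) * x) ^ 2 ≤ 25 / 9 := by
      have : 0 ≤ (M : ℝ) * x := by positivity
      nlinarith
    have h5 : u (j + 3) * 42 ≤ u (j + 2) * ((M : ℝ) * x) ^ 2 := by
      have := mul_le_mul_of_nonneg_right h3 (pow_nonneg hx (2 * (j + 2) + 1 + 2))
      simp only [hu]
      calc _ = (M.choose (2 * (j + 2) + 1 + 2) : ℝ) * 42 * x ^ (2 * (j + 2) + 1 + 2) := by
            rw [show 2 * (j + 3) + 1 = 2 * (j + 2) + 1 + 2 by ring]; ring
        _ ≤ _ := this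
        _ = _ := by rw [pow_add x _ 2]; ring
    have h6 : 0 ≤ u (j + 2) := by positivity
    have := mul_le_mul_of_nonneg_left h4 h6
    linarith
  -- Here 15/14 = 1/(1 - 1/15); keeping the next term on the left makes the induction close.
  have htail (n : ℕ) : ∑ j ∈ Finset.range n, u (j + 2) + 15 / 14 * u (n + 2) ≤
      15 / 14 * u 2 := by
    induction n with
    | zero => simp
    | succ n ih =>
      rw [Finset.sum_range_succ]
      have := hratio n
      rw [show n + 1 + 2 = n + 3 by ring]
      linarith
  -- Combined with the tail factor, 15/14 · 1/120 = 1/112.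
  have h5 : u 2 ≤ (M * x) ^ 5 / 120 := by
    have := Nat.choose_le_pow_div (α := ℝ) 5 M
    have h := mul_le_mul_of_nonneg_right this (pow_nonneg hx 5)
    calc u 2 ≤ _ := h
      _ = _ := by norm_num [Nat.factorial]; ring
  have hM : 0 ≤ u (M + 2) := by positivity
  have h := htail M
  rw [sub_pow_div_two_eq_sum, Finset.sum_range_succ', Finset.sum_range_succ']
  have h0 : (M.choose (2 * 0 + 1) : ℝ) * x ^ (2 * 0 + 1) = M * x := by simp
  have h1 : (M.choose (2 * (0 + 1) + 1) : ℝ) * x ^ (2 * (0 + 1) + 1) =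
      (M : ℝ) * (M - 1) * (M - 2) / 6 * x ^ 3 := by
    rw [← cast_choose_three]
  rw [h0, h1]
  change ∑ j ∈ Finset.range M, u (j + 2) + _ + _ ≤ _
  linarith

/-- The polynomial inequality in `t = M / k` and `u = 1 / M`. -/
theorem poly_bound {a t u : ℝ} (ha0 : 0 ≤ a) (ha : a ≤ 4 / 5) (ht0 : 0 ≤ t)
    (hat : 6 / 10 * t + 1 / 2 * (a * t) ≤ 1) (hu0 : 0 ≤ u) (hu : u ≤ 1 / 8) :
    a * t + (1 - a) * u * t ^ 2 + (1 / 6 - u / 2 + u ^ 2 / 3) * t ^ 3 + t ^ 5 / 112 ≤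
      98 / 100 := by
  have hc : 0 ≤ 1 / 6 - u / 2 + u ^ 2 / 3 := by nlinarith
  have ht : t ≤ 5 / 3 := by nlinarith [mul_nonneg ha0 ht0]
  -- The value at the corner t = 1, a = 4/5, where the two constraints on a meet.
  have hG0 : 8 / 10 + 2 / 10 * u + (1 / 6 - u / 2 + u ^ 2 / 3) + 1 / 112 ≤ 98 / 100 := by
    nlinarith
  have hut : 0 ≤ 1 - u * t := by nlinarith
  rcases le_total t 1 with h1 | h1
  · have h2 : t ^ 2 ≤ 1 := pow_le_one₀ ht0 h1
    have h3 : t ^ 3 ≤ 1 := pow_le_one₀ ht0 h1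
    have h5 : t ^ 5 ≤ 1 := pow_le_one₀ ht0 h1
    have e1 : a * t + (1 - a) * u * t ^ 2 ≤ 8 / 10 * t + 2 / 10 * (u * t ^ 2) := by
      nlinarith [mul_nonneg (sub_nonneg.2 ha) (mul_nonneg ht0 hut)]
    have e2 := mul_le_mul_of_nonneg_left h2 hu0
    have e3 := mul_le_mul_of_nonneg_left h3 hc
    linarith
  -- For 1 ≤ t ≤ 5/3 the constraint gives a t ≤ 2 - 1.2 t. Each power of t is then bounded by its
  -- chord on [1, 5/3], so only the endpoints need checking.
  · obtain ⟨s, rfl⟩ : ∃ s, t = 1 + s := ⟨t - 1, by ring⟩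
    have hs0 : 0 ≤ s := by linarith
    have hs : s ≤ 2 / 3 := by linarith
    have hss : 0 ≤ s * (2 / 3 - s) := mul_nonneg hs0 (by linarith)
    have h2 : (1 + s) ^ 2 ≤ 1 + 8 / 3 * s := by nlinarith
    have h3 : (1 + s) ^ 3 ≤ 1 + 49 / 9 * s := by nlinarith [mul_nonneg hs0 hss]
    have h5 : (1 + s) ^ 5 ≤ 1 + 1441 / 81 * s := by
      nlinarith [mul_nonneg hs0 hss, mul_nonneg hs0 (mul_nonneg hs0 hss),
        mul_nonneg hs0 (mul_nonneg hs0 (mul_nonneg hs0 hss))]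
    have e1 : a * (1 + s) + (1 - a) * u * (1 + s) ^ 2 ≤
        (2 - 12 / 10 * (1 + s)) * (1 - u * (1 + s)) + u * (1 + s) ^ 2 := by
      have := mul_le_mul_of_nonneg_right
        (by linarith : a * (1 + s) ≤ 2 - 12 / 10 * (1 + s)) hut
      linarith
    have e2 := mul_le_mul_of_nonneg_left h2 hu0
    have e3 := mul_le_mul_of_nonneg_left h3 hc
    -- The value at t = 5/3, where a = 0. It exceeds 0.98 at u = 1/7, so the cases M ≤ 7 are treated
    -- separately.
    have hG1 : u * (25 / 9) + (1 / 6 - u / 2 + u ^ 2 / 3) * (125 / 27) +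
        3125 / 243 / 112 ≤ 98 / 100 := by nlinarith
    have c0 := mul_le_mul_of_nonneg_left hG0 (by linarith : 0 ≤ 1 - 3 / 2 * s)
    have c1 := mul_le_mul_of_nonneg_left hG1 (by linarith : 0 ≤ 3 / 2 * s)
    linarith

theorem small_bound {M g k : ℕ} (hM4 : 4 ≤ M) (hM7 : M ≤ 7) (hg : 10 * g ≤ 8 * M)
    (hk : 6 * M + 5 * g ≤ 10 * k) {x : ℝ} (hx0 : 0 ≤ x) (hx : x * k = 1) :
    ((1 + x) ^ M - (1 - x) ^ M) / 2 - (M - g) * (x - x ^ 2) ≤ 98 / 100 := by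
  have hkR : (6 * M + 5 * g : ℝ) ≤ 10 * k := by exact_mod_cast hk
  have hxy : x * (6 * M + 5 * g) ≤ 10 := by
    have := mul_le_mul_of_nonneg_left hkR hx0
    linarith
  have hx3 : x ≤ 1 / 3 := by
    have : (3 : ℝ) ≤ k := by exact_mod_cast (by omega : 3 ≤ k)
    have := mul_le_mul_of_nonneg_left this hx0
    linarith
  have hg5 : g ≤ 5 := by omega
  have hexp : ((1 + x) ^ M - (1 - x) ^ M) / 2 = M * x + M.choose 3 * x ^ 3 +
      M.choose 5 * x ^ 5 + M.choose 7 * x ^ 7 := by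
    interval_cases M <;> norm_num [Nat.choose] <;> ring
  have hgM : (0 : ℝ) ≤ M - g := by
    rw [sub_nonneg]
    exact_mod_cast (by omega : g ≤ M)
  -- After M x - (M - g) x = g x all coefficients are nonnegative, so the expression is monotone in
  -- x and may be evaluated at any upper bound for x.
  have key (y : ℝ) (hy : x ≤ y) :
      ((1 + x) ^ M - (1 - x) ^ M) / 2 - (M - g) * (x - x ^ 2) ≤
      g * y + (M - g) * y ^ 2 + M.choose 3 * y ^ 3 + M.choose 5 * y ^ 5 + M.choose 7 * y ^ 7 := by
    rw [hexp]
    calc _ = g * x + (M - g) * x ^ 2 + M.choose 3 * x ^ 3 + M.choose 5 * x ^ 5 +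
          M.choose 7 * x ^ 7 := by ring
      _ ≤ _ := by gcongr
  -- Here the bound x ≤ 10/24 just fails to give 0.98; integrality of k gives k ≥ 3 and x ≤ 1/3.
  by_cases h40 : M = 4 ∧ g = 0
  · obtain ⟨rfl, rfl⟩ := h40
    refine (key _ hx3).trans ?_
    norm_num [Nat.choose]
  · refine (key (10 / (6 * M + 5 * g)) ?_).trans ?_
    · rw [le_div_iff₀ (by positivity)]
      exact hxy
    · clear key hexp
      interval_cases M <;> interval_cases g <;> first | omega | norm_num [Nat.choose]

/-- Finitely many pairs (M, g) are checked for M ≤ 7; for M ≥ 8 the odd part is truncated and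
`poly_bound` applies with a = g/M, t = M/k, u = 1/M. -/
theorem cancellation_bound {M g k : ℕ} (hM4 : 4 ≤ M) (hg : 10 * g ≤ 8 * M)
    (hk : 6 * M + 5 * g ≤ 10 * k) {x : ℝ} (hx0 : 0 ≤ x) (hx : x * k = 1) :
    ((1 + x) ^ M - (1 - x) ^ M) / 2 - (M - g) * (x - x ^ 2) ≤ 98 / 100 := by
  rcases le_or_gt M 7 with hM7 | hM8
  · exact small_bound hM4 hM7 hg hk hx0 hx
  have hM0 : (0 : ℝ) < M := by exact_mod_cast (by omega : 0 < M)
  have hM8R : (8 : ℝ) ≤ M := by exact_mod_cast hM8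
  have hkR : (6 * M + 5 * g : ℝ) ≤ 10 * k := by exact_mod_cast hk
  have hgR : (10 * g : ℝ) ≤ 8 * M := by exact_mod_cast hg
  have hxy : x * (6 * M + 5 * g) ≤ 10 := by
    have := mul_le_mul_of_nonneg_left hkR hx0
    linarith
  have hgx : 0 ≤ x * g := by positivity
  have h1 := odd_part_le M hx0 (by linarith)
  have e1 : (g : ℝ) / M * (M * x) = g * x := by field_simp
  have h2 := poly_bound (a := g / M) (t := M * x) (u := 1 / M) (by positivity)
    (by rw [div_le_iff₀ hM0]; linarith) (by positivity) (by rw [e1]; linarith)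
    (by positivity) (by rw [div_le_div_iff₀ hM0 (by norm_num)]; linarith)
  have e2 : (g : ℝ) / M * (M * x) + (1 - g / M) * (1 / M) * (M * x) ^ 2 +
      (1 / 6 - 1 / M / 2 + (1 / M) ^ 2 / 3) * (M * x) ^ 3 + (M * x) ^ 5 / 112 =
      g * x + (M - g) * x ^ 2 + (M : ℝ) * (M - 1) * (M - 2) / 6 * x ^ 3 + (M * x) ^ 5 / 112 := by
    field_simp
    ring
  rw [e2] at h2
  linarith

end RealBounds

/-! ### Translation to hypergraphs and the main theorem. -/

namespace Hypergraph

open EdgeFamily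

variable {α : Type*}

open Classical in
/-- The vertices of an edge, as a finite set of vertices. -/
noncomputable def edgeVertices (H : Hypergraph α) [Fintype H.vertexSet] (e : Set α) :
    Finset H.vertexSet :=
  Finset.univ.filter fun v => (v : α) ∈ e

theorem mem_edgeVertices {H : Hypergraph α} [Fintype H.vertexSet] {e : Set α} {v : H.vertexSet} :
    v ∈ H.edgeVertices e ↔ (v : α) ∈ e := by
  simp [edgeVertices]

theorem card_edgeVertices {H : Hypergraph α} [Fintype H.vertexSet] {e : Set α}
    (he : e ⊆ H.vertexSet) : (H.edgeVertices e).card = e.ncard := by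
  rw [← Set.ncard_coe_finset, ← Set.ncard_image_of_injective _ Subtype.val_injective]
  congr 1
  ext v
  simp only [Set.mem_image, Finset.mem_coe, mem_edgeVertices, Subtype.exists, exists_and_left,
    exists_prop, exists_eq_right_right]
  exact ⟨fun h => h.1, fun h => ⟨h, he h⟩⟩

theorem subset_vertexSet {H : Hypergraph α} {e : Set α} (he : e ∈ H.edgeSet) :
    e ⊆ H.vertexSet :=
  H.subset_vertexSet_of_mem_edgeSet' he

theorem isProperColoring_iff {C ι : Type*} {H : Hypergraph α} [Fintype H.vertexSet]
    (e : ι ≃ H.edgeSet) (θ : H.vertexSet → C) :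
    H.IsProperColoring θ ↔ ∀ i, ¬ Mono θ (H.edgeVertices (e i)) := by
  have h1 (s : Set α) : 2 ≤ (θ '' {v : H.vertexSet | (v : α) ∈ s}).ncard ↔
      ¬ Mono θ (H.edgeVertices s) := by
    rw [Nat.succ_le_iff, Set.one_lt_ncard (Set.toFinite _)]
    simp only [Mono, mem_edgeVertices]
    push Not
    simp
  simp only [IsProperColoring, h1]
  exact ⟨fun h i => h _ (e i).2, fun h s hs => by simpa using h (e.symm ⟨s, hs⟩)⟩

theorem listColorings_eq {ι : Type*} {H : Hypergraph α} [Fintype H.vertexSet]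
    [DecidableEq H.vertexSet] (e : ι ≃ H.edgeSet) (L : H.vertexSet → Finset ℕ) :
    H.listColorings L = properCount (fun i => H.edgeVertices (e i)) L := by
  rw [listColorings, properCount]
  classical
  refine Nat.subtype_card _ fun θ => ?_
  rw [Finset.mem_filter, Fintype.mem_piFinset, isProperColoring_iff e]

theorem chromaticPoly_eq_listColorings (H : Hypergraph α) [Fintype H.vertexSet] (k : ℕ) :
    H.chromaticPoly k = H.listColorings fun _ => Finset.range k := by
  refine Nat.card_congr
    { toFun := fun θ => ⟨fun v => θ.1 v, fun v => Finset.mem_range.2 (θ.1 v).2, ?_⟩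
      invFun := fun θ => ⟨fun v => ⟨θ.1 v, Finset.mem_range.1 (θ.2.1 v)⟩, ?_⟩
      left_inv := fun θ => rfl
      right_inv := fun θ => rfl }
  · have := θ.2
    rw [isProperColoring_iff (Equiv.refl _)] at this ⊢
    simpa [Mono, Fin.ext_iff] using this
  · have := θ.2.2
    rw [isProperColoring_iff (Equiv.refl _)] at this ⊢
    simpa [Mono, Fin.ext_iff] using this

theorem edgeDefect_eq {H : Hypergraph α} [Fintype H.vertexSet] [DecidableEq H.vertexSet] (k : ℕ)
    (L : H.vertexSet → Finset ℕ) {s : Set α} (hs : (H.edgeVertices s).Nonempty) :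
    H.edgeDefect k L s = (k : ℤ) - (common L (H.edgeVertices s)).card := by
  rw [edgeDefect, ← Set.ncard_coe_finset]
  congr 3
  ext c
  simp [mem_common hs, mem_edgeVertices]

theorem defect_eq_sum {ι : Type*} [Fintype ι] {H : Hypergraph α} [Fintype H.vertexSet]
    [DecidableEq H.vertexSet] (e : ι ≃ H.edgeSet) (k : ℕ) (L : H.vertexSet → Finset ℕ)
    (hE : ∀ i, (H.edgeVertices (e i)).Nonempty) :
    (H.defect k L : ℝ) = ∑ i, defectAt k (fun i => H.edgeVertices (e i)) L i := by
  rw [defect, ← finsum_set_coe_eq_finsum_mem, ← finsum_comp_equiv e, finsum_eq_sum_of_fintype]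
  push_cast
  refine Finset.sum_congr rfl fun i _ => ?_
  rw [edgeDefect_eq k L (hE i), defectAt]
  push_cast
  rfl

theorem card_near_le_gam {ι : Type*} [Fintype ι] {H : Hypergraph α} [Fintype H.vertexSet]
    [DecidableEq H.vertexSet] (e : ι ≃ H.edgeSet) (r : ℕ) (i : ι) :
    (Finset.univ.filter fun j =>
      (H.edgeVertices (e i) ∩ H.edgeVertices (e j)).card + 1 = r).card ≤ H.gam r := by
  have hfin : H.edgeSet.Finite := Set.finite_coe_iff.1 (Finite.of_equiv ι e)
  have hsub (s : Set α) : H.nearEdges r s ⊆ H.edgeSet := fun _ h => h.1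
  have hbdd : BddAbove {g : ℕ | ∃ s ∈ H.edgeSet, (H.nearEdges r s).ncard = g} := by
    refine ⟨H.edgeSet.ncard, ?_⟩
    rintro _ ⟨s, _, rfl⟩
    exact Set.ncard_le_ncard (hsub s) hfin
  refine le_trans ?_ (le_csSup hbdd ⟨e i, (e i).2, rfl⟩)
  rw [← Set.ncard_coe_finset, ← Set.ncard_image_of_injective _
    (Subtype.val_injective.comp e.injective)]
  refine Set.ncard_le_ncard ?_ (hfin.subset (hsub _))
  rintro _ ⟨j, hj, rfl⟩
  refine ⟨(e j).2, ?_⟩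
  have : H.edgeVertices (e i) ∩ H.edgeVertices (e j) =
      H.edgeVertices ((e i : Set α) ∩ (e j : Set α)) := by
    ext v
    simp [mem_edgeVertices]
  simp only [Finset.coe_filter, Finset.mem_univ, true_and, Set.mem_ofPred_eq] at hj
  rwa [this, card_edgeVertices (Set.inter_subset_left.trans (subset_vertexSet (e i).2))] at hj

theorem defect_nonneg {H : Hypergraph α} {k r : ℕ} (hfin : H.vertexSet.Finite)
    (hE : H.edgeSet.Finite) (hr : 1 ≤ r) (hunif : H.IsUniform r) {L : H.vertexSet → Finset ℕ}
    (hL : H.IsAssignment k L) : 0 ≤ (H.defect k L : ℝ) := by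
  classical
  have : Fintype H.vertexSet := hfin.fintype
  have : Fintype H.edgeSet := hE.fintype
  have hne (i : H.edgeSet) : (H.edgeVertices (Equiv.refl _ i : H.edgeSet)).Nonempty := by
    rw [← Finset.card_pos, card_edgeVertices (subset_vertexSet (Subtype.prop _)),
      hunif _ (Subtype.prop _)]
    omega
  rw [defect_eq_sum (Equiv.refl _) k L hne]
  exact Finset.sum_nonneg fun i _ => defectAt_nonneg hL (hne i)

theorem mul_defect_le {H : Hypergraph α} {r M k : ℕ} (hfin : H.vertexSet.Finite)
    (hm : H.edgeSet.ncard = M + 1) (hr : 3 ≤ r) (hM : 4 ≤ M) (hunif : H.IsUniform r)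
    (hgam : 10 * H.gam r ≤ 8 * M) (hk : 6 * M + 5 * H.gam r ≤ 10 * k)
    {L : H.vertexSet → Finset ℕ} (hL : H.IsAssignment k L) :
    0.02 * (k : ℝ) ^ (H.vertexSet.ncard - r) * (H.defect k L : ℝ) ≤
      (H.listColorings L : ℝ) - (H.chromaticPoly k : ℝ) := by
  classical
  have : Fintype H.vertexSet := hfin.fintype
  have hE : H.edgeSet.Finite := Set.finite_of_ncard_ne_zero (by omega)
  have hcard : Nat.card H.edgeSet = M + 1 := hm
  have : Finite H.edgeSet := hE
  -- Any enumeration will do: it supplies the linear order on edges that broken edges require.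
  let e : Fin (M + 1) ≃ H.edgeSet := (Finite.equivFinOfCardEq hcard).symm
  have hEr (i : Fin (M + 1)) : (H.edgeVertices (e i)).card = r := by
    rw [card_edgeVertices (subset_vertexSet (e i).2), hunif _ (e i).2]
  have hne (i : Fin (M + 1)) : (H.edgeVertices (e i)).Nonempty :=
    Finset.card_pos.1 (by rw [hEr]; omega)
  have hinj : Function.Injective fun i => H.edgeVertices (e i) := by
    intro i j hij
    refine e.injective (Subtype.ext (Set.ext fun v => ?_))
    constructor <;> intro hv
    · exact mem_edgeVertices.1 ((congrArg ((⟨v, subset_vertexSet (e i).2 hv⟩ : H.vertexSet) ∈ ·)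
        hij).mp (mem_edgeVertices.2 hv))
    · exact mem_edgeVertices.1 ((congrArg ((⟨v, subset_vertexSet (e j).2 hv⟩ : H.vertexSet) ∈ ·)
        hij).mpr (mem_edgeVertices.2 hv))
  have hk1 : 1 ≤ k := by omega
  have hx : ((k : ℝ)⁻¹) * k = 1 := inv_mul_cancel₀ (by positivity)
  have h1 := mul_sum_defectAt_le hk1 hr hL hinj hEr (card_near_le_gam e r)
    (Fintype.card_fin (M + 1)) hx
  rw [← listColorings_eq e, ← listColorings_eq e, ← chromaticPoly_eq_listColorings,
    ← defect_eq_sum e k L hne] at h1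
  have h2 := cancellation_bound hM hgam hk (by positivity) hx
  have h3 := defect_nonneg hfin hE (by omega) hunif hL
  have hV : H.vertexSet.ncard = Fintype.card H.vertexSet := by
    rw [← Nat.card_coe_set_eq, Nat.card_eq_fintype_card]
  rw [hV]
  refine le_trans ?_ h1
  rw [mul_right_comm, mul_comm _ ((k : ℝ) ^ _)]
  refine mul_le_mul_of_nonneg_left (mul_le_mul_of_nonneg_right ?_ h3) (by positivity)
  norm_num at h2 ⊢
  linarith

/-- Constant lists attain P(H,k), and the lower bound with nonnegative total defect shows that no
assignment does better. -/
theorem listColorFunction_eq {H : Hypergraph α} {r M k : ℕ} (hfin : H.vertexSet.Finite)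
    (hm : H.edgeSet.ncard = M + 1) (hr : 3 ≤ r) (hM : 4 ≤ M) (hunif : H.IsUniform r)
    (hgam : 10 * H.gam r ≤ 8 * M) (hk : 6 * M + 5 * H.gam r ≤ 10 * k) :
    H.listColorFunction k = H.chromaticPoly k := by
  have : Fintype H.vertexSet := hfin.fintype
  have hmem : H.chromaticPoly k ∈ {p : ℕ | ∃ L : H.vertexSet → Finset ℕ,
      H.IsAssignment k L ∧ H.listColorings L = p} :=
    ⟨fun _ => Finset.range k, fun _ => Finset.card_range k,
      (H.chromaticPoly_eq_listColorings k).symm⟩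
  refine le_antisymm (Nat.sInf_le hmem) (le_csInf ⟨_, hmem⟩ ?_)
  rintro _ ⟨L, hL, rfl⟩
  have h1 := mul_defect_le hfin hm hr hM hunif hgam hk hL
  have h2 := defect_nonneg hfin (Set.finite_of_ncard_ne_zero (by omega)) (by omega) hunif hL
  have h3 : 0 ≤ 0.02 * (k : ℝ) ^ (H.vertexSet.ncard - r) * (H.defect k L : ℝ) := by positivity
  exact_mod_cast sub_nonneg.1 (h3.trans h1)

theorem tauPrime_le {H : Hypergraph α} {q : ℕ} (hq : 0 < q)
    (h : ∀ k : ℕ, q ≤ k → H.listColorFunction k = H.chromaticPoly k) : H.tauPrime ≤ (q : ℕ∞) :=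
  sInf_le ⟨q, rfl, hq, h⟩

end Hypergraph

theorem mainTheorem1 {α : Type*} (H : Hypergraph α) (r n m : ℕ)
    (hfin : H.vertexSet.Finite)
    (hn : H.vertexSet.ncard = n) (hm : H.edgeSet.ncard = m)
    (hr : 3 ≤ r) (hm5 : 5 ≤ m) (hunif : H.IsUniform r)
    (hgam : (H.gam r : ℝ) ≤ 0.8 * ((m : ℝ) - 1)) :
    (∀ k : ℕ, 0.6 * ((m : ℝ) - 1) + 0.5 * (H.gam r : ℝ) ≤ (k : ℝ) →
      ∀ L : H.vertexSet → Finset ℕ, H.IsAssignment k L →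
        0.02 * (k : ℝ) ^ (n - r) * (H.defect k L : ℝ) ≤
          (H.listColorings L : ℝ) - (H.chromaticPoly k : ℝ)) ∧
    (∀ k : ℕ, 0.6 * ((m : ℝ) - 1) + 0.5 * (H.gam r : ℝ) ≤ (k : ℝ) →
      H.listColorFunction k = H.chromaticPoly k) ∧
    H.tauPrime ≤ ((⌈0.6 * ((m : ℝ) - 1) + 0.5 * (H.gam r : ℝ)⌉₊ : ℕ) : ℕ∞) ∧
    H.tauPrime ≤ ((m - 1 : ℕ) : ℕ∞) ∧
    0.6 * ((m : ℝ) - 1) + 0.5 * (H.gam r : ℝ) ≤ (m : ℝ) - 1 := by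
  subst hn
  obtain ⟨M, rfl⟩ : ∃ M, m = M + 1 := ⟨m - 1, by omega⟩
  have hM : 4 ≤ M := by omega
  have hcast : ((M + 1 : ℕ) : ℝ) - 1 = M := by simp
  have hM0 : (0 : ℝ) < M := by exact_mod_cast (by omega : 0 < M)
  rw [hcast] at hgam ⊢
  have hgam' : 10 * H.gam r ≤ 8 * M := by
    have : (10 * H.gam r : ℝ) ≤ 8 * M := by linarith
    exact_mod_cast this
  have hk' (k : ℕ) (hk : 0.6 * (M : ℝ) + 0.5 * (H.gam r : ℝ) ≤ (k : ℝ)) :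
      6 * M + 5 * H.gam r ≤ 10 * k := by
    have : (6 * M + 5 * H.gam r : ℝ) ≤ 10 * k := by linarith
    exact_mod_cast this
  -- The hypothesis on γ enters through 0.6 + 0.5 · 0.8 = 1.
  have hle : 0.6 * (M : ℝ) + 0.5 * (H.gam r : ℝ) ≤ M := by linarith
  have heq (k : ℕ) (hk : 0.6 * (M : ℝ) + 0.5 * (H.gam r : ℝ) ≤ (k : ℝ)) :
      H.listColorFunction k = H.chromaticPoly k :=
    Hypergraph.listColorFunction_eq hfin hm hr hM hunif hgam' (hk' k hk)
  refine ⟨fun k hk L hL => Hypergraph.mul_defect_le hfin hm hr hM hunif hgam' (hk' k hk) hL, heq,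
    Hypergraph.tauPrime_le (Nat.ceil_pos.2 (by positivity)) fun k hk => heq k (Nat.ceil_le.1 hk),
    Hypergraph.tauPrime_le (by omega) fun k hk => heq k (hle.trans ?_), hle⟩
  exact_mod_cast hk
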